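/- All Banach spaces are real. For a compact Hausdorff space $K$, $C(K)$ is the space of continuous real-valued functions on $K$ with the maximum norm. For a Banach space $X$ let $B_{X^*}$ and $S_{X^*}$ be the closed unit ball and the unit sphere of $X^*$, let $\operatorname{Ext} A$ denote the set of extreme points of $A$, and for $x\in X$ with $\|x\|=1$ put $\mathfrak F(x)=\{x^*\in S_{X^*}: \langle x,x^*\rangle=1\}$. A linear isometry (into) $T\colon X\to Y$ between Banach spaces is a U-embedding if for every $x^*\in S_{X^*}$ there is exactly one $y^*\in Y^*$ with $T^*y^*=x^*$ and $\|y^*\|=\|x^*\|$. A $w^*$-closed set $E\subset B_{X^*}$ is a proper U-suitable set of $X$ if (i) $E\cap(-E)\cap S_{X^*}=\emptyset$; (ii) $E\cup(-E)=\overline{\operatorname{Ext} B_{X^*}}^{\,w^*}$; (iii) $E\cap\mathfrak F(x)=E\cap\overline{\operatorname{Ext}\mathfrak F(x)}^{\,w^*}$ for every $x\in X$ with $\|x\|=1$. A simplex is a compact convex set $S$ in a locally convex space $V$ such that the cone $P=\{t(s,1): t\ge 0,\ s\in S\}\subset V\times\mathbb R$ makes $P-P$, ordered by $p\le q\iff q-p\in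 P$, a lattice. A simplexoid is a compact convex set in a locally convex space all of whose nonempty proper closed faces are simplices. Theorem. Let $X$ be a finite-dimensional Banach space. There exist a compact Hausdorff space $K$ and a U-embedding $T\colon X\to C(K)$ if and only if $X$ admits a proper U-suitable set and $B_{X^*}$, with its $w^*$-topology, is a simplexoid. -/

import Mathlib

open scoped Pointwise

universe u v w

section UEmbedding

variable {X : Type u} [NormedAddCommGroup X] [NormedSpace ℝ X]
  {Y : Type v} [NormedAddCommGroup Y] [NormedSpace ℝ Y]

/-- `g` is a Hahn--Banach (norm-preserving) extension of `f` through the isometry `T`: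
the adjoint of `T` maps `g` to `f`, and `‖g‖ = ‖f‖`. -/
def IsHahnBanachExtension (T : X →ₗᵢ[ℝ] Y) (f : StrongDual ℝ X) (g : StrongDual ℝ Y) : Prop :=
  g.comp T.toContinuousLinearMap = f ∧ ‖g‖ = ‖f‖

/-- A linear isometry into `T : X → Y` is a U-embedding if every norm-one functional on `X` has a
unique Hahn--Banach extension through `T`. -/
def IsUEmbedding (T : X →ₗᵢ[ℝ] Y) : Prop :=
  ∀ f : StrongDual ℝ X, ‖f‖ = 1 → ∃! g : StrongDual ℝ Y, IsHahnBanachExtension T f g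

end UEmbedding

/-- `X` can be U-embedded into the space `C(K)` of real continuous functions, with the maximum
norm, on some compact Hausdorff space `K`. -/
def UEmbedsInSomeCK (X : Type u) [NormedAddCommGroup X] [NormedSpace ℝ X] : Prop :=
  ∃ (K : Type v) (_ : TopologicalSpace K) (_ : CompactSpace K) (_ : T2Space K)
    (T : X →ₗᵢ[ℝ] C(K, ℝ)), IsUEmbedding T

section DualBall

variable (X : Type u) [NormedAddCommGroup X] [NormedSpace ℝ X]

/-- The closed unit ball of the dual of `X`, as a subset of the dual with its weak* topology. -/
def dualBall : Set (WeakDual ℝ X) := {f | ‖WeakDual.toStrongDual f‖ ≤ 1}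

/-- The unit sphere of the dual of `X`, as a subset of the dual with its weak* topology. -/
def dualSphere : Set (WeakDual ℝ X) := {f | ‖WeakDual.toStrongDual f‖ = 1}

variable {X}

/-- The face of the dual unit ball defined by `x`: the norm-one functionals with value `1`
at `x`. -/
def dualFace (x : X) : Set (WeakDual ℝ X) := {f | f ∈ dualSphere X ∧ f x = 1}

/-- U-suitable sets. Closedness and closures refer to the weak* topology. -/
structure IsUSuitable (E : Set (WeakDual ℝ X)) : Prop where
  subset_ball : E ⊆ dualBall X
  isClosed : IsClosed E
  inter_neg : E ∩ (-E) ∩ dualSphere X = ∅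
  union_neg : E ∪ (-E) = closure ((dualBall X).extremePoints ℝ)

/-- Proper U-suitable sets. -/
structure IsProperUSuitable (E : Set (WeakDual ℝ X)) : Prop extends IsUSuitable E where
  inter_face : ∀ x : X, ‖x‖ = 1 →
    E ∩ dualFace x = E ∩ closure ((dualFace x).extremePoints ℝ)

end DualBall

section Simplexoid

variable {V : Type w} [AddCommGroup V] [Module ℝ V]

/-- The cone in `V × ℝ` generated by `S × {1}`, for a convex set `S`. -/
def coneOver (S : Set V) : Set (V × ℝ) := {p | ∃ t : ℝ, 0 ≤ t ∧ ∃ x ∈ S, p = t • (x, (1 : ℝ))}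

/-- The vector space `coneOver S - coneOver S`, ordered by `p ≤ q ↔ q - p ∈ coneOver S`, is a
lattice. (Infima exist as soon as suprema do, because `p ↦ -p` reverses the order.) -/
def IsLatticeBase (S : Set V) : Prop :=
  ∀ p ∈ coneOver S - coneOver S, ∀ q ∈ coneOver S - coneOver S,
    ∃ r ∈ coneOver S - coneOver S,
      (r - p ∈ coneOver S ∧ r - q ∈ coneOver S) ∧
      ∀ s ∈ coneOver S - coneOver S,
        s - p ∈ coneOver S → s - q ∈ coneOver S → s - r ∈ coneOver S

variable [TopologicalSpace V]

/-- A simplex in the sense of Choquet: a compact convex set `S` such that the cone with base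
`S × {1}` induces a lattice order on the space it spans. -/
def IsChoquetSimplex (S : Set V) : Prop := IsCompact S ∧ Convex ℝ S ∧ IsLatticeBase S

/-- `F` is a nonempty proper closed face of the convex set `S`. -/
def IsProperClosedFace (S F : Set V) : Prop :=
  IsExtreme ℝ S F ∧ Convex ℝ F ∧ IsClosed F ∧ F.Nonempty ∧ F ≠ S

/-- A simplexoid: a compact convex set whose proper closed faces are simplices. -/
def IsSimplexoid (S : Set V) : Prop :=
  IsCompact S ∧ Convex ℝ S ∧ ∀ F : Set V, IsProperClosedFace S F → IsChoquetSimplex F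

end Simplexoid

/-! ### Cones over convex sets: the lattice condition and affine independence of extreme points. -/

section ConeOver

variable {V : Type w} [AddCommGroup V] [Module ℝ V]

/-! In finite dimensions a nonempty compact convex set is a simplex exactly when its extreme points
are affinely independent (`IsLatticeBase.linearIndependent_extremePoints`,
`isChoquetSimplex_of_linearIndependent`).

Necessity: let `E` be the set of norm-one functionals `T*δ_k`. Unique extension transfers the
extremality of `δ_k` to `T*δ_k`, and `±T*δ_k` are norming, so `E ∪ -E` is the set of extreme points
of the dual ball. A proper face lies in the sphere and its extreme points are `±T*δ_k` with distinct
`k`. Two convex combinations of them with the same value would extend to two equal combinations of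
independent signed evaluations, so these extreme points are affinely independent.

Sufficiency: take `K = E` and let `X` act by evaluation. If `f` attains its norm at `x`, every
extension `μ` of `f` is concentrated on the points of `E` with value `±1` at `x`. By properness
these are, up to sign, extreme points of the simplex `dualFace x`, hence finitely many and
independent. Each `g` in `C(K)` therefore agrees there with some `T y`, and `μ g = f y` does not
depend on `μ`. -/

theorem smul_mem_coneOver {S : Set V} {x : V} (hx : x ∈ S) {t : ℝ} (ht : 0 ≤ t) :
    t • (x, (1 : ℝ)) ∈ coneOver S :=
  ⟨t, ht, x, hx, rfl⟩

theorem snd_nonneg_of_mem_coneOver {S : Set V} {p : V × ℝ} (hp : p ∈ coneOver S) : 0 ≤ p.2 := by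
  obtain ⟨t, ht, x, -, rfl⟩ := hp
  simpa using ht

theorem Convex.add_mem_coneOver {S : Set V} (hS : Convex ℝ S) {p q : V × ℝ}
    (hp : p ∈ coneOver S) (hq : q ∈ coneOver S) : p + q ∈ coneOver S := by
  obtain ⟨a, ha, x, hx, rfl⟩ := hp
  obtain ⟨b, hb, y, hy, rfl⟩ := hq
  rcases (add_nonneg ha hb).eq_or_lt with h | h
  · have ha0 : a = 0 := by linarith
    have hb0 : b = 0 := by linarith
    exact ⟨0, le_rfl, x, hx, by simp [ha0, hb0]⟩
  · refine ⟨a + b, h.le, (a / (a + b)) • x + (b / (a + b)) • y,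
      hS hx hy (by positivity) (by positivity) (by field_simp), ?_⟩
    ext
    · simp only [Prod.smul_fst, Prod.fst_add, smul_add, smul_smul, mul_div_cancel₀ _ h.ne']
    · simp

theorem Convex.sum_mem_coneOver {S : Set V} (hS : Convex ℝ S) (hne : S.Nonempty) {ι : Type*}
    {s : Finset ι} {p : ι → V × ℝ} (hp : ∀ i ∈ s, p i ∈ coneOver S) :
    ∑ i ∈ s, p i ∈ coneOver S := by
  classical
  induction s using Finset.induction_on with
  | empty => exact ⟨0, le_rfl, hne.some, hne.some_mem, by simp⟩
  | insert i s hi ih =>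
    rw [Finset.sum_insert hi]
    exact hS.add_mem_coneOver (hp i (Finset.mem_insert_self i s))
      (ih fun j hj => hp j (Finset.mem_insert_of_mem hj))

/-- An extreme point spans an extreme ray of the cone: a splitting of `t • (e, 1)` becomes, after
normalization, a convex combination equal to `e`. -/
theorem eq_smul_of_sub_mem_coneOver {S : Set V} {e : V} (he : e ∈ S.extremePoints ℝ)
    {p : V × ℝ} {t : ℝ} (hp : p ∈ coneOver S) (h : t • (e, (1 : ℝ)) - p ∈ coneOver S) :
    p = p.2 • (e, (1 : ℝ)) := by
  obtain ⟨a, ha, x, hx, rfl⟩ := hp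
  obtain ⟨b, hb, y, hy, h⟩ := h
  have h1 : t • e - a • x = b • y := by simpa using congrArg Prod.fst h
  have h2 : t - a = b := by simpa using congrArg Prod.snd h
  obtain rfl : t = a + b := by linarith
  rcases ha.eq_or_lt with rfl | ha
  · simp
  have hxe : x = e := by
    rcases hb.eq_or_lt with rfl | hb
    · have : a • e = a • x := by simpa [sub_eq_zero] using h1
      exact (smul_right_injective V ha.ne' this).symm
    · refine (mem_extremePoints.1 he).2 x hx y hy
        ⟨a / (a + b), b / (a + b), by positivity, by positivity, by field_simp, ?_⟩ |>.1
      have h3 : (a + b) • e = a • x + b • y := by rw [← h1]; abel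
      rw [div_eq_inv_mul, div_eq_inv_mul, mul_smul, mul_smul, ← smul_add, ← h3,
        inv_smul_smul₀ (by positivity)]
  simp [hxe]

/-- Multiples of distinct extreme points are disjoint in the lattice, and `p ≤ r + q` with `p ∧ r =
0` gives `p ≤ q`. The summands are thus removed one at a time, down to the empty sum. -/
theorem IsLatticeBase.nonpos_of_sub_mem_coneOver {S : Set V} (hS : Convex ℝ S)
    (hL : IsLatticeBase S) (s : Finset (S.extremePoints ℝ)) (b : S.extremePoints ℝ → ℝ)
    (hb : ∀ i, 0 ≤ b i) (i : S.extremePoints ℝ) (hi : i ∉ s) (c : ℝ)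
    (h : ∑ j ∈ s, b j • ((j : V), (1 : ℝ)) - c • ((i : V), (1 : ℝ)) ∈ coneOver S) : c ≤ 0 := by
  classical
  have hne : S.Nonempty := ⟨i, i.2.1⟩
  have h0 : (0 : V × ℝ) ∈ coneOver S := ⟨0, le_rfl, i, i.2.1, by simp⟩
  have hsub : ∀ p ∈ coneOver S, p ∈ coneOver S - coneOver S := fun p hp =>
    ⟨p, hp, 0, h0, sub_zero p⟩
  induction s using Finset.induction_on with
  | empty =>
    have := snd_nonneg_of_mem_coneOver h
    simpa using this
  | insert j s hj ih =>
    rw [Finset.mem_insert, not_or] at hi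
    rw [Finset.sum_insert hj] at h
    by_contra! hc
    refine hc.not_ge (ih hi.2 ?_)
    set p := c • ((i : V), (1 : ℝ)) with hp
    set r := b j • ((j : V), (1 : ℝ)) with hr
    set q := ∑ j ∈ s, b j • ((j : V), (1 : ℝ)) with hq
    have hpP : p ∈ coneOver S := smul_mem_coneOver i.2.1 hc.le
    have hrP : r ∈ coneOver S := smul_mem_coneOver j.2.1 (hb j)
    have hqP : q ∈ coneOver S :=
      hS.sum_mem_coneOver hne fun k _ => smul_mem_coneOver k.2.1 (hb k)
    obtain ⟨m, -, ⟨hmp, hmr⟩, hm⟩ := hL p (hsub p hpP) r (hsub r hrP)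
    -- As `m = p ∨ r`, this element is `p ∧ r`; it lies on both extreme rays and so vanishes.
    have hw : p + r - m ∈ coneOver S :=
      hm _ (hsub _ (hS.add_mem_coneOver hpP hrP)) (by simpa using hrP) (by simpa using hpP)
    have hw1 := eq_smul_of_sub_mem_coneOver i.2 (t := c) hw
      (by rw [← hp]; convert hmr using 1; abel)
    have hw2 := eq_smul_of_sub_mem_coneOver j.2 (t := b j) hw
      (by rw [← hr]; convert hmp using 1; abel)
    have hij : (i : V) - j ≠ 0 := fun hij => hi.1 (Subtype.ext (sub_eq_zero.1 hij))
    have hw3 : (p + r - m).2 • ((i : V) - j) = 0 := by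
      have := congrArg Prod.fst (hw1.symm.trans hw2)
      rw [smul_sub, sub_eq_zero]
      exact this
    have hw4 : p + r - m = 0 := by
      rw [hw1, (smul_eq_zero.1 hw3).resolve_right hij, zero_smul]
    -- Now `m = p + r`, so the upper bound `r + q` of `p` and `r` satisfies `p + r ≤ r + q`.
    have := hm (r + q) (hsub _ (hS.add_mem_coneOver hrP hqP)) h (by simpa using hqP)
    rw [← sub_eq_zero.1 hw4] at this
    convert this using 1
    abel

/-- The extreme points of a set satisfying the lattice condition are affinely independent. -/
theorem IsLatticeBase.linearIndependent_extremePoints {S : Set V} (hS : Convex ℝ S)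
    (hL : IsLatticeBase S) :
    LinearIndependent ℝ fun e : S.extremePoints ℝ => ((e : V), (1 : ℝ)) := by
  classical
  -- A vanishing combination puts `g i • (i, 1)` below the sum of `|g j| • (j, 1)` over the other
  -- `j`. Applying this to `g` and `-g` gives `g i = 0`.
  have key : ∀ (s : Finset (S.extremePoints ℝ)) (g : S.extremePoints ℝ → ℝ),
      ∑ j ∈ s, g j • ((j : V), (1 : ℝ)) = 0 → ∀ i ∈ s, g i ≤ 0 := by
    intro s g hg i hi
    refine hL.nonpos_of_sub_mem_coneOver hS (s.erase i) (fun j => |g j|) (fun j => abs_nonneg _) i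
      (Finset.notMem_erase i s) (g i) ?_
    rw [← Finset.add_sum_erase s _ hi, add_eq_zero_iff_eq_neg] at hg
    rw [hg, sub_neg_eq_add, ← Finset.sum_add_distrib]
    refine hS.sum_mem_coneOver ⟨i, i.2.1⟩ fun j _ => ?_
    rw [← add_smul]
    exact smul_mem_coneOver j.2.1 (by linarith [neg_abs_le (g j)])
  rw [linearIndependent_iff']
  intro s g hg i hi
  refine le_antisymm (key s g hg i hi) ?_
  have := key s (-g) (by simp only [Pi.neg_apply, neg_smul, Finset.sum_neg_distrib, hg, neg_zero]) i hi
  simpa using this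

theorem coneOver_convexHull_range {ι : Type*} [Fintype ι] [Nonempty ι] (e : ι → V) :
    coneOver (convexHull ℝ (Set.range e)) =
      Fintype.linearCombination ℝ (fun i => (e i, (1 : ℝ))) '' {c | 0 ≤ c} := by
  ext p
  constructor
  · rintro ⟨t, ht, x, hx, rfl⟩
    rw [convexHull_range_eq_exists_affineCombination] at hx
    obtain ⟨s, w, hw0, hw1, rfl⟩ := hx
    classical
    refine ⟨fun i => if i ∈ s then t * w i else 0, fun i => ?_, ?_⟩
    · dsimp only [Pi.zero_apply]
      split_ifs with h
      exacts [mul_nonneg ht (hw0 i h), le_rfl]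
    · rw [s.affineCombination_eq_linear_combination _ _ hw1, Fintype.linearCombination_apply]
      simp only [ite_smul, zero_smul, Finset.sum_ite_mem, Finset.univ_inter]
      ext
      · simp [Prod.fst_sum, Finset.smul_sum, smul_smul]
      · simp [Prod.snd_sum, ← Finset.mul_sum, hw1]
  · rintro ⟨c, hc, rfl⟩
    rw [Fintype.linearCombination_apply]
    exact (convex_convexHull ℝ _).sum_mem_coneOver
      ((Set.range_nonempty e).mono (subset_convexHull ℝ _)) fun i _ =>
        smul_mem_coneOver (subset_convexHull ℝ _ (Set.mem_range_self i)) (hc i)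

/-- The convex hull of finitely many affinely independent points satisfies the lattice
condition. -/
theorem isLatticeBase_convexHull_range {ι : Type*} [Finite ι] [Nonempty ι] {e : ι → V}
    (he : LinearIndependent ℝ fun i => (e i, (1 : ℝ))) :
    IsLatticeBase (convexHull ℝ (Set.range e)) := by
  cases nonempty_fintype ι
  have hinj := linearIndependent_iff_injective_fintypeLinearCombination.1 he
  rw [IsLatticeBase, coneOver_convexHull_range]
  set L := Fintype.linearCombination ℝ (fun i => (e i, (1 : ℝ)))
  -- By injectivity of `L` the cone order is the coordinatewise order, and joins are taken
  -- coordinatewise.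
  have hmem : ∀ c, L c ∈ L '' {c | 0 ≤ c} ↔ 0 ≤ c := fun c => hinj.mem_set_image
  have hsub : ∀ c, L c ∈ L '' {c | 0 ≤ c} - L '' {c | 0 ≤ c} := fun c =>
    ⟨L c⁺, (hmem _).2 (posPart_nonneg c), L c⁻, (hmem _).2 (negPart_nonneg c), by
      simp only
      rw [← map_sub, posPart_sub_negPart]⟩
  rintro _ ⟨_, ⟨a, -, rfl⟩, _, ⟨a', -, rfl⟩, rfl⟩ _ ⟨_, ⟨b, -, rfl⟩, _, ⟨b', -, rfl⟩, rfl⟩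
  simp only [← map_sub]
  refine ⟨L ((a - a') ⊔ (b - b')), hsub _, ⟨?_, ?_⟩, ?_⟩
  · rw [← map_sub, hmem]
    exact sub_nonneg.2 le_sup_left
  · rw [← map_sub, hmem]
    exact sub_nonneg.2 le_sup_right
  · rintro _ ⟨_, ⟨c, -, rfl⟩, _, ⟨c', -, rfl⟩, rfl⟩
    simp only [← map_sub, hmem, sub_nonneg]
    exact sup_le

end ConeOver

/-! ### Compactness of convex hulls in finite dimensions. -/

section ConvexHull

variable {V : Type w} [AddCommGroup V] [Module ℝ V] [TopologicalSpace V] [ContinuousAdd V]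
  [ContinuousSMul ℝ V]

/-- In a finite-dimensional space the convex hull of a compact set is compact. -/
theorem IsCompact.convexHull_of_finiteDimensional [FiniteDimensional ℝ V] {s : Set V}
    (hs : IsCompact s) : IsCompact (convexHull ℝ s) := by
  classical
  rcases s.eq_empty_or_nonempty with rfl | ⟨x₀, hx₀⟩
  · simp
  let n := Module.finrank ℝ V + 1
  let f : (Fin n → ℝ) × (Fin n → V) → V := fun q => ∑ i, q.1 i • q.2 i
  have hf : Continuous f := by fun_prop
  -- Carathéodory: `n` points suffice, so the hull is a continuous image of a compact set.
  have himg : convexHull ℝ s = f '' (stdSimplex ℝ (Fin n) ×ˢ Set.univ.pi fun _ => s) := by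
    apply Set.Subset.antisymm
    · intro x hx
      obtain ⟨ι, _, z, w, hz, hind, hw0, hw1, rfl⟩ := eq_pos_convex_span_of_mem_convexHull hx
      have hcard : Fintype.card ι ≤ Fintype.card (Fin n) := by
        rw [Fintype.card_fin]
        exact hind.card_le_finrank_succ.trans (Nat.succ_le_succ (Submodule.finrank_le _))
      obtain ⟨j⟩ := Function.Embedding.nonempty_of_card_le hcard
      have hw : ∀ k ∉ Set.range j, Function.extend j w 0 k = 0 := fun k hk =>
        Function.extend_apply' _ _ _ hk
      -- Shorter families are padded with weight `0` at the point `x₀`.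
      refine ⟨(Function.extend j w 0, Function.extend j z fun _ => x₀),
        ⟨⟨fun k => ?_, ?_⟩, fun k _ => ?_⟩, ?_⟩
      · by_cases hk : k ∈ Set.range j
        · obtain ⟨i, rfl⟩ := hk
          simpa [j.injective.extend_apply] using (hw0 i).le
        · exact (hw k hk).ge
      · rw [← hw1]
        refine (Fintype.sum_of_injective j j.injective _ _ (fun k hk => hw k hk) fun i => ?_).symm
        rw [j.injective.extend_apply]
      · by_cases hk : k ∈ Set.range j
        · obtain ⟨i, rfl⟩ := hk
          simpa [j.injective.extend_apply] using hz ⟨i, rfl⟩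
        · simpa [Function.extend_apply' _ _ _ hk] using hx₀
      · refine (Fintype.sum_of_injective j j.injective _ _ (fun k hk => ?_) fun i => ?_).symm
        · simp [hw k hk]
        · simp [j.injective.extend_apply]
    · rintro _ ⟨⟨w, z⟩, ⟨hw, hz⟩, rfl⟩
      exact (convex_convexHull ℝ s).sum_mem (fun i _ => hw.1 i) hw.2 fun i _ =>
        subset_convexHull ℝ s (hz i trivial)
  rw [himg]
  exact ((isCompact_stdSimplex ℝ (Fin n)).prod (isCompact_univ_pi fun _ => hs)).image hf

end ConvexHull

/-! ### Faces and extreme points of the dual ball. -/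

section DualBallBasics

variable {X : Type u} [NormedAddCommGroup X] [NormedSpace ℝ X]

theorem isCompact_dualBall : IsCompact (dualBall X) := by
  convert WeakDual.isCompact_closedBall (𝕜 := ℝ) (0 : StrongDual ℝ X) 1 using 1
  ext f
  simp [dualBall]

theorem convex_dualBall : Convex ℝ (dualBall X) := by
  intro f hf g hg a b ha hb hab
  have := convex_closedBall (0 : StrongDual ℝ X) 1 (mem_closedBall_zero_iff.2 hf)
    (mem_closedBall_zero_iff.2 hg) ha hb hab
  exact mem_closedBall_zero_iff.1 this

theorem neg_mem_dualBall {f : WeakDual ℝ X} : -f ∈ dualBall X ↔ f ∈ dualBall X := by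
  simp [dualBall]

theorem neg_dualBall : -dualBall X = dualBall X := by
  ext f
  exact neg_mem_dualBall

theorem dualSphere_subset_dualBall : dualSphere X ⊆ dualBall X := fun _ hf => le_of_eq hf

theorem abs_apply_le_of_mem_dualBall {f : WeakDual ℝ X} (hf : f ∈ dualBall X) (x : X) :
    |f x| ≤ ‖x‖ := by
  have := (WeakDual.toStrongDual f).le_of_opNorm_le hf x
  simpa using this

theorem neg_mem_extremePoints_dualBall {f : WeakDual ℝ X}
    (hf : f ∈ (dualBall X).extremePoints ℝ) : -f ∈ (dualBall X).extremePoints ℝ := by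
  have := image_extremePoints (𝕜 := ℝ) (LinearEquiv.neg ℝ : WeakDual ℝ X ≃ₗ[ℝ] WeakDual ℝ X) (dualBall X)
  have h2 : (LinearEquiv.neg ℝ : WeakDual ℝ X ≃ₗ[ℝ] WeakDual ℝ X) '' dualBall X = dualBall X := by
    conv_rhs => rw [← neg_dualBall, ← Set.image_neg_eq_neg]
    rfl
  rw [h2] at this
  rw [← this]
  exact ⟨f, hf, rfl⟩

theorem dualFace_eq {x : X} (hx : ‖x‖ = 1) : dualFace x = {f | f ∈ dualBall X ∧ f x = 1} := by
  ext f
  refine ⟨fun h => ⟨dualSphere_subset_dualBall h.1, h.2⟩, fun h => ⟨le_antisymm h.1 ?_, h.2⟩⟩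
  have := (WeakDual.toStrongDual f).le_opNorm x
  simpa [hx, h.2] using this

theorem isClosed_dualFace {x : X} (hx : ‖x‖ = 1) : IsClosed (dualFace x) := by
  rw [dualFace_eq hx]
  exact isCompact_dualBall.isClosed.inter
    (isClosed_eq (WeakDual.eval_continuous x) continuous_const)

theorem convex_dualFace {x : X} (hx : ‖x‖ = 1) : Convex ℝ (dualFace x) := by
  rw [dualFace_eq hx]
  refine convex_dualBall.inter fun f hf g hg a b ha hb hab => ?_
  change a * f x + b * g x = 1
  rw [show f x = 1 from hf, show g x = 1 from hg, mul_one, mul_one, hab]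

theorem isExtreme_dualFace {x : X} (hx : ‖x‖ = 1) : IsExtreme ℝ (dualBall X) (dualFace x) := by
  refine ⟨fun f hf => dualSphere_subset_dualBall hf.1, ?_⟩
  rintro f hf g hg k hk ⟨a, b, ha, hb, hab, rfl⟩
  rw [dualFace_eq hx]
  refine ⟨hf, ?_⟩
  have h1 : a * f x + b * g x = 1 := hk.2
  have h2 := (le_abs_self _).trans (abs_apply_le_of_mem_dualBall hf x)
  have h3 := (le_abs_self _).trans (abs_apply_le_of_mem_dualBall hg x)
  rw [hx] at h2 h3
  refine le_antisymm h2 ?_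
  nlinarith

theorem exists_mem_dualFace [FiniteDimensional ℝ X] {f : WeakDual ℝ X} (hf : f ∈ dualSphere X) :
    ∃ x : X, ‖x‖ = 1 ∧ f ∈ dualFace x := by
  have hf' : ‖WeakDual.toStrongDual f‖ = 1 := hf
  have : Nontrivial X := by
    by_contra h
    rw [not_nontrivial_iff_subsingleton] at h
    rw [Subsingleton.elim (WeakDual.toStrongDual f) 0] at hf'
    simp at hf'
  have := FiniteDimensional.proper ℝ X
  obtain ⟨x, hx, hmax⟩ := (isCompact_sphere (0 : X) 1).exists_isMaxOn
    (NormedSpace.sphere_nonempty.2 zero_le_one) (WeakDual.toStrongDual f).continuous.continuousOn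
  rw [mem_sphere_zero_iff_norm] at hx
  refine ⟨x, hx, hf, le_antisymm ?_ ?_⟩
  · simpa [hx] using (le_abs_self _).trans
      (abs_apply_le_of_mem_dualBall (dualSphere_subset_dualBall hf) x)
  · have habs : ∀ y, ‖y‖ = 1 → |f y| ≤ f x := fun y hy =>
      abs_le'.2 ⟨hmax (mem_sphere_zero_iff_norm.2 hy), by
        have : f (-y) ≤ f x := hmax (by simpa using hy)
        rwa [map_neg] at this⟩
    rw [← hf']
    exact ContinuousLinearMap.opNorm_le_of_unit_norm ((abs_nonneg _).trans (habs x hx)) habs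

/-- A proper face of the dual ball lies in the dual sphere. -/
theorem IsExtreme.subset_dualSphere {F : Set (WeakDual ℝ X)} (hF : IsExtreme ℝ (dualBall X) F)
    (hne : F ≠ dualBall X) : F ⊆ dualSphere X := by
  intro f hf
  by_contra h
  have hlt : ‖WeakDual.toStrongDual f‖ < 1 := lt_of_le_of_ne (hF.1 hf) h
  refine hne (hF.1.antisymm fun g hg => ?_)
  set r := ‖WeakDual.toStrongDual f‖ with hr
  -- The segment from `g` to `f` can be prolonged past `f` by the factor `δ` inside the ball, since
  -- `r + 2 * δ = 1`. Then `f` is interior to a segment ending at `g`, which puts `g` in `F`.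
  set δ := (1 - r) / 2 with hδ
  have hδ0 : 0 < δ := by rw [hδ]; linarith
  have hg' : ‖WeakDual.toStrongDual g‖ ≤ 1 := hg
  have hz : f + δ • (f - g) ∈ dualBall X := by
    change ‖WeakDual.toStrongDual (f + δ • (f - g))‖ ≤ 1
    rw [map_add, map_smul, map_sub]
    refine (norm_add_le _ _).trans ?_
    rw [norm_smul, Real.norm_of_nonneg hδ0.le]
    have := norm_sub_le (WeakDual.toStrongDual f) (WeakDual.toStrongDual g)
    rw [← hr] at this ⊢
    have h2 : δ * ‖WeakDual.toStrongDual f - WeakDual.toStrongDual g‖ ≤ δ * 2 :=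
      mul_le_mul_of_nonneg_left (by linarith) hδ0.le
    rw [hδ] at h2 ⊢
    linarith
  refine hF.2 hg hz hf ⟨δ / (1 + δ), 1 / (1 + δ), by positivity, by positivity, by field_simp; ring,
    ?_⟩
  rw [div_eq_inv_mul, div_eq_inv_mul, mul_smul, mul_smul, ← smul_add, one_smul,
    inv_smul_eq_iff₀ (by positivity)]
  module

/-- An extreme point is a one-point face; it is proper because the ball contains some `g ≠ -g`. -/
theorem extremePoints_dualBall_subset_dualSphere [Nontrivial X] :
    (dualBall X).extremePoints ℝ ⊆ dualSphere X := by
  intro f hf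
  refine (isExtreme_singleton.2 hf).subset_dualSphere (fun h => ?_) rfl
  obtain ⟨x, hx⟩ := exists_ne (0 : X)
  obtain ⟨g, hg1, hg⟩ := exists_dual_vector ℝ x (norm_ne_zero_iff.2 hx)
  have h1 : StrongDual.toWeakDual g ∈ ({f} : Set (WeakDual ℝ X)) := by
    rw [h]; exact hg1.le
  have h2 : -StrongDual.toWeakDual g ∈ ({f} : Set (WeakDual ℝ X)) := by
    rw [h, neg_mem_dualBall]; exact hg1.le
  have h3 := congrArg (fun k : WeakDual ℝ X => k x)
    ((Set.mem_singleton_iff.1 h1).trans (Set.mem_singleton_iff.1 h2).symm)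
  have h4 : g x = -g x := h3
  rw [hg] at h4
  have := norm_pos_iff.2 hx
  simp only [RCLike.ofReal_real_eq_id, id_eq] at h4
  linarith

instance WeakDual.finiteDimensional [FiniteDimensional ℝ X] : FiniteDimensional ℝ (WeakDual ℝ X) :=
  Module.Finite.equiv (StrongDual.toWeakDual : StrongDual ℝ X ≃ₗ[ℝ] WeakDual ℝ X)

instance WeakDual.locallyConvexSpace_real : LocallyConvexSpace ℝ (WeakDual ℝ X) :=
  inferInstanceAs (LocallyConvexSpace ℝ (WeakBilin (topDualPairing ℝ X)))

end DualBallBasics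

/-! ### From affine independence to simplices. -/

section FiniteDimensionalSimplex

variable {V : Type w} [AddCommGroup V] [Module ℝ V] [FiniteDimensional ℝ V]

theorem finite_of_linearIndependent_prod_one {s : Set V}
    (h : LinearIndependent ℝ fun e : s => ((e : V), (1 : ℝ))) : s.Finite :=
  Set.finite_coe_iff.1 h.finite

variable [TopologicalSpace V] [IsTopologicalAddGroup V] [ContinuousSMul ℝ V] [T2Space V]
  [LocallyConvexSpace ℝ V]

/-- A nonempty compact convex set with affinely independent extreme points is a simplex. -/
theorem isChoquetSimplex_of_linearIndependent {S : Set V} (hc : IsCompact S) (hS : Convex ℝ S)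
    (hne : S.Nonempty)
    (h : LinearIndependent ℝ fun e : S.extremePoints ℝ => ((e : V), (1 : ℝ))) :
    IsChoquetSimplex S := by
  refine ⟨hc, hS, ?_⟩
  have hfin := finite_of_linearIndependent_prod_one h
  have := hfin.to_subtype
  have := (hc.extremePoints_nonempty hne).to_subtype
  -- Krein–Milman; the hull of finitely many points is already closed.
  have hull := closure_convexHull_extremePoints hc hS
  rw [(hfin.isCompact_convexHull (𝕜 := ℝ)).isClosed.closure_eq] at hull
  have := isLatticeBase_convexHull_range h
  rwa [Subtype.range_coe, hull] at this

end FiniteDimensionalSimplex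

/-! ### Point evaluations on `C(K)`: extremality and independence. -/

section PointEvaluation

variable {K : Type v} [TopologicalSpace K] [CompactSpace K]

theorem norm_evalCLM_le (k : K) : ‖(ContinuousMap.evalCLM ℝ k : C(K, ℝ) →L[ℝ] ℝ)‖ ≤ 1 :=
  ContinuousLinearMap.opNorm_le_bound _ zero_le_one fun g => by
    simpa using g.norm_coe_le_norm k

/-- Point evaluations are extreme points of the dual ball of `C(K)`. -/
theorem eq_evalCLM_of_convex_combination {k : K} {μ ν : StrongDual ℝ C(K, ℝ)} (hμ : ‖μ‖ ≤ 1)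
    (hν : ‖ν‖ ≤ 1) {a b : ℝ} (ha : 0 < a) (hb : 0 < b) (hab : a + b = 1)
    (h : a • μ + b • ν = ContinuousMap.evalCLM ℝ k) : μ = ContinuousMap.evalCLM ℝ k := by
  have happ : ∀ g : C(K, ℝ), a * μ g + b * ν g = g k := fun g => by
    have := congrArg (fun τ : StrongDual ℝ C(K, ℝ) => τ g) h
    simpa using this
  have hle : ∀ τ : StrongDual ℝ C(K, ℝ), ‖τ‖ ≤ 1 → ∀ g : C(K, ℝ), ‖g‖ ≤ 1 → τ g ≤ 1 :=
    fun τ hτ g hg => (le_abs_self _).trans <| (τ.le_of_opNorm_le hτ g).trans (by simpa using hg)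
  have hone : ∀ g : C(K, ℝ), ‖g‖ ≤ 1 → g k = 1 → μ g = 1 := fun g hg hgk => by
    have h1 := hle μ hμ g hg
    have h2 := hle ν hν g hg
    have h3 := happ g
    rw [hgk] at h3
    refine le_antisymm h1 ?_
    nlinarith
  -- Both `1 - |g|` and `1 - |g| + g` lie in the unit ball and take the value `1` at `k`, so `μ` is
  -- `1` on each.
  have hzero : ∀ g : C(K, ℝ), ‖g‖ ≤ 1 → g k = 0 → μ g = 0 := fun g hg hgk => by
    have hb : ∀ t, |g t| ≤ 1 := fun t => (g.norm_coe_le_norm t).trans hg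
    have h1 : μ (1 - |g|) = 1 := hone _ ((ContinuousMap.norm_le _ zero_le_one).2 fun t => by
      simp only [ContinuousMap.sub_apply, ContinuousMap.one_apply, ContinuousMap.abs_apply,
        Real.norm_eq_abs]
      rw [abs_le]
      constructor <;> linarith [hb t, abs_nonneg (g t)]) (by simp [hgk])
    have h2 : μ (1 - |g| + g) = 1 := hone _ ((ContinuousMap.norm_le _ zero_le_one).2 fun t => by
      simp only [ContinuousMap.sub_apply, ContinuousMap.add_apply, ContinuousMap.one_apply,
        ContinuousMap.abs_apply, Real.norm_eq_abs]
      rw [abs_le]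
      constructor <;> linarith [hb t, neg_abs_le (g t), le_abs_self (g t)]) (by simp [hgk])
    rw [map_add, h1] at h2
    linarith
  have hzero' : ∀ g : C(K, ℝ), g k = 0 → μ g = 0 := fun g hgk => by
    rcases eq_or_ne g 0 with rfl | hg
    · simp
    have h1 := hzero (‖g‖⁻¹ • g) (by simp [norm_smul, hg]) (by simp [hgk])
    simpa [hg] using h1
  ext g
  have h1 := hzero' (g - g k • 1) (by simp)
  have h2 := hone 1 ((ContinuousMap.norm_le _ zero_le_one).2 fun t => by simp) (by simp)
  rw [map_sub, map_smul, h2] at h1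
  simpa [sub_eq_zero] using h1

/-- Evaluations at distinct points, with signs, are linearly independent. -/
theorem linearIndependent_smul_evalCLM [T2Space K] {ι : Type*} {k : ι → K}
    (hk : Function.Injective k) {ε : ι → ℝ} (hε : ∀ i, ε i ≠ 0) :
    LinearIndependent ℝ fun i => ε i • (ContinuousMap.evalCLM ℝ (k i) : C(K, ℝ) →L[ℝ] ℝ) := by
  classical
  rw [linearIndependent_iff']
  intro s g hg i hi
  obtain ⟨f, hf0, hf1, -⟩ := exists_continuous_zero_one_of_isClosed
    (((s.erase i).finite_toSet.image k).isClosed) (isClosed_singleton (x := k i))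
    (Set.disjoint_singleton_right.2 fun ⟨j, hj, hji⟩ =>
      (Finset.mem_erase.1 hj).1 (hk hji))
  have h1 := congrArg (fun τ : StrongDual ℝ C(K, ℝ) => τ f) hg
  simp only [_root_.sum_apply, _root_.smul_apply,
    _root_.zero_apply] at h1
  rw [Finset.sum_eq_single_of_mem i hi] at h1
  · have : f (k i) = 1 := hf1 rfl
    simpa [this, hε i] using h1
  · intro j hj hji
    have : f (k j) = 0 := hf0 ⟨j, Finset.mem_erase.2 ⟨hji, hj⟩, rfl⟩
    simp [this]

end PointEvaluation

theorem norm_sum_smul_le_one {E : Type*} [SeminormedAddCommGroup E] [NormedSpace ℝ E] {ι : Type*}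
    {s : Finset ι} {w : ι → ℝ} {z : ι → E} (hw : ∀ i ∈ s, 0 ≤ w i) (hw1 : ∑ i ∈ s, w i = 1)
    (hz : ∀ i ∈ s, ‖z i‖ ≤ 1) : ‖∑ i ∈ s, w i • z i‖ ≤ 1 :=
  mem_closedBall_zero_iff.1 <| (convex_closedBall (0 : E) 1).sum_mem hw hw1 fun i hi =>
    mem_closedBall_zero_iff.2 (hz i hi)

/-- Turns a linear relation into an equality of two nonnegative combinations; for an affine
relation, `A` will be the common weight of both sides. -/
theorem sum_posPart_div_smul_eq_iff {M : Type*} [AddCommGroup M] [Module ℝ M] {ι : Type*}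
    {s : Finset ι} {g : ι → ℝ} {z : ι → M} {A : ℝ} (hA : A ≠ 0) :
    ∑ i ∈ s, ((g i)⁺ / A) • z i = ∑ i ∈ s, ((g i)⁻ / A) • z i ↔ ∑ i ∈ s, g i • z i = 0 := by
  rw [← sub_eq_zero, ← Finset.sum_sub_distrib]
  simp only [← sub_smul, ← sub_div, posPart_sub_negPart]
  simp only [div_eq_inv_mul, mul_smul]
  rw [← Finset.smul_sum, smul_eq_zero_iff_right (inv_ne_zero hA)]

/-! ### Necessity: consequences of a U-embedding into `C(K)`. -/

section Necessity

variable {X : Type u} [NormedAddCommGroup X] [NormedSpace ℝ X]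

/-- Restriction along an isometry does not increase the norm, so `‖μ‖ ≤ 1` already makes an
extension of `f` norm-preserving. -/
theorem IsUEmbedding.eq_of_comp_eq {Y : Type v} [NormedAddCommGroup Y] [NormedSpace ℝ Y]
    {T : X →ₗᵢ[ℝ] Y} (hT : IsUEmbedding T) {f : StrongDual ℝ X} (hf : ‖f‖ = 1)
    {μ ν : StrongDual ℝ Y} (hμ : ‖μ‖ ≤ 1) (hν : ‖ν‖ ≤ 1)
    (hμf : μ.comp T.toContinuousLinearMap = f) (hνf : ν.comp T.toContinuousLinearMap = f) :
    μ = ν := by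
  have key : ∀ τ : StrongDual ℝ Y, ‖τ‖ ≤ 1 → τ.comp T.toContinuousLinearMap = f →
      IsHahnBanachExtension T f τ := fun τ hτ h => by
    refine ⟨h, le_antisymm (hτ.trans hf.ge) ?_⟩
    rw [← h]
    refine ContinuousLinearMap.opNorm_le_bound _ (norm_nonneg τ) fun x => ?_
    simpa using τ.le_opNorm (T x)
  exact (hT f hf).unique (key μ hμ hμf) (key ν hν hνf)

variable {K : Type v} [TopologicalSpace K] [CompactSpace K]

/-- The functional `x ↦ T x k`, that is, the image of the point evaluation at `k` under the
adjoint of `T`. -/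
noncomputable def adjointEval (T : X →ₗᵢ[ℝ] C(K, ℝ)) (k : K) : WeakDual ℝ X :=
  StrongDual.toWeakDual ((ContinuousMap.evalCLM ℝ k).comp T.toContinuousLinearMap)

@[simp]
theorem adjointEval_apply (T : X →ₗᵢ[ℝ] C(K, ℝ)) (k : K) (x : X) : adjointEval T k x = T x k :=
  rfl

theorem continuous_adjointEval (T : X →ₗᵢ[ℝ] C(K, ℝ)) : Continuous (adjointEval T) :=
  WeakDual.continuous_of_continuous_eval fun x => (T x).continuous

theorem adjointEval_mem_dualBall (T : X →ₗᵢ[ℝ] C(K, ℝ)) (k : K) :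
    adjointEval T k ∈ dualBall X :=
  ContinuousLinearMap.opNorm_le_bound _ zero_le_one fun x => by
    simpa using (T x).norm_coe_le_norm k

/-- Otherwise uniqueness would give `-δ_l = δ_k`, which fails on the constant `1`. -/
theorem neg_adjointEval_ne {T : X →ₗᵢ[ℝ] C(K, ℝ)} (hT : IsUEmbedding T) {k l : K}
    (hk : adjointEval T k ∈ dualSphere X) : -adjointEval T l ≠ adjointEval T k := by
  intro h
  have := hT.eq_of_comp_eq hk (μ := -ContinuousMap.evalCLM ℝ l) (ν := ContinuousMap.evalCLM ℝ k)
    (by simpa using norm_evalCLM_le l) (norm_evalCLM_le k) h rfl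
  have h1 := congrArg (fun τ : StrongDual ℝ C(K, ℝ) => τ 1) this
  norm_num at h1

/-- If `T*δ_k` is a proper convex combination of `f` and `g`, both have norm one. The same
combination of their extensions extends `T*δ_k`, so it is `δ_k`, which is extreme. -/
theorem adjointEval_mem_extremePoints {T : X →ₗᵢ[ℝ] C(K, ℝ)} (hT : IsUEmbedding T) {k : K}
    (hk : adjointEval T k ∈ dualSphere X) :
    adjointEval T k ∈ (dualBall X).extremePoints ℝ := by
  refine mem_extremePoints_iff_left.2 ⟨dualSphere_subset_dualBall hk, ?_⟩
  rintro f hf g hg ⟨a, b, ha, hb, hab, h⟩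
  have hk' : ‖WeakDual.toStrongDual (adjointEval T k)‖ = 1 := hk
  have hf' : ‖WeakDual.toStrongDual f‖ ≤ 1 := hf
  have hg' : ‖WeakDual.toStrongDual g‖ ≤ 1 := hg
  have hle : (1 : ℝ) ≤ a * ‖WeakDual.toStrongDual f‖ + b * ‖WeakDual.toStrongDual g‖ := by
    rw [← hk', ← h, map_add, map_smul, map_smul]
    refine (norm_add_le _ _).trans_eq ?_
    rw [norm_smul, norm_smul, Real.norm_of_nonneg ha.le, Real.norm_of_nonneg hb.le]
  have hf1 : ‖WeakDual.toStrongDual f‖ = 1 := le_antisymm hf' (by nlinarith)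
  have hg1 : ‖WeakDual.toStrongDual g‖ = 1 := le_antisymm hg' (by nlinarith)
  obtain ⟨μ, ⟨hμ, hμn⟩, -⟩ := hT _ hf1
  obtain ⟨ν, ⟨hν, hνn⟩, -⟩ := hT _ hg1
  have hμ1 := (hμn.trans hf1).le
  have hν1 := (hνn.trans hg1).le
  have hcomb : a • μ + b • ν = ContinuousMap.evalCLM ℝ k := by
    refine hT.eq_of_comp_eq hk' ?_ (norm_evalCLM_le k) ?_ rfl
    · exact mem_closedBall_zero_iff.1 <| convex_closedBall (0 : StrongDual ℝ C(K, ℝ)) 1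
        (mem_closedBall_zero_iff.2 hμ1) (mem_closedBall_zero_iff.2 hν1) ha.le hb.le hab
    · rw [← h, ContinuousLinearMap.add_comp, ContinuousLinearMap.smul_comp,
        ContinuousLinearMap.smul_comp, hμ, hν]
      rfl
  have := eq_evalCLM_of_convex_combination hμ1 hν1 ha hb hab hcomb
  apply (WeakDual.toStrongDual (𝕜 := ℝ) (E := X)).injective
  rw [← hμ, this]
  rfl

/-- The set `±T*δ_k` is compact and norming. By Hahn–Banach separation, with weak* continuous
functionals given by points of `X`, its hull is the whole ball; extreme points of a hull lie in the
generating set. -/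
theorem extremePoints_dualBall_subset [FiniteDimensional ℝ X] [Nontrivial X]
    (T : X →ₗᵢ[ℝ] C(K, ℝ)) :
    (dualBall X).extremePoints ℝ ⊆ Set.range (adjointEval T) ∪ -Set.range (adjointEval T) := by
  have hK : Nonempty K := by
    by_contra h
    rw [not_nonempty_iff] at h
    have : Subsingleton C(K, ℝ) := ⟨fun f g => ContinuousMap.ext fun k => h.elim k⟩
    exact not_subsingleton X T.injective.subsingleton
  set A := Set.range (adjointEval T) ∪ -Set.range (adjointEval T) with hA
  have hAc : IsCompact A :=
    (isCompact_range (continuous_adjointEval T)).union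
      (isCompact_range (continuous_adjointEval T)).neg
  have hsub : dualBall X ⊆ convexHull ℝ A := by
    intro f hf
    by_contra hfA
    obtain ⟨ℓ, u, hu, huf⟩ := geometric_hahn_banach_closed_point (convex_convexHull ℝ A)
      hAc.convexHull_of_finiteDimensional.isClosed hfA
    obtain ⟨x, hx⟩ := LinearMap.dualEmbedding_surjective (topDualPairing ℝ X) ℓ
    have hx' : ∀ g : WeakDual ℝ X, ℓ g = g x := fun g => by rw [← hx]; rfl
    have hT : ‖T x‖ ≤ u := by
      refine (ContinuousMap.norm_le_of_nonempty (T x)).2 fun k => abs_le'.2 ⟨?_, ?_⟩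
      · simpa [hx'] using (hu _ (subset_convexHull ℝ A (Or.inl ⟨k, rfl⟩))).le
      · have := hu (-adjointEval T k) (subset_convexHull ℝ A (Or.inr (by simp)))
        rw [map_neg, hx'] at this
        exact this.le
    rw [T.norm_map] at hT
    have := (le_abs_self _).trans (abs_apply_le_of_mem_dualBall hf x)
    rw [← hx'] at this
    linarith
  have hAB : A ⊆ dualBall X := by
    rintro f (⟨k, rfl⟩ | ⟨k, hk⟩)
    · exact adjointEval_mem_dualBall T k
    · rw [← neg_mem_dualBall, ← hk]
      exact adjointEval_mem_dualBall T k
  rw [← (convexHull_min hAB convex_dualBall).antisymm hsub]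
  exact extremePoints_convexHull_subset

theorem exists_isProperUSuitable [FiniteDimensional ℝ X] {T : X →ₗᵢ[ℝ] C(K, ℝ)}
    (hT : IsUEmbedding T) : ∃ E : Set (WeakDual ℝ X), IsProperUSuitable E := by
  rcases subsingleton_or_nontrivial X with hX | hX
  -- For `X = 0` the extreme point of the dual ball is `0`, off the sphere, so the set `E` used
  -- below would be empty.
  · have hW : Subsingleton (WeakDual ℝ X) :=
      ⟨fun f g => DFunLike.ext _ _ fun x => by rw [Subsingleton.elim x 0, map_zero, map_zero]⟩
    have hB : dualBall X = Set.univ := Set.eq_univ_of_forall fun f => by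
      rw [Subsingleton.elim f 0]
      simp [dualBall]
    have hneg : -(Set.univ : Set (WeakDual ℝ X)) = Set.univ := by simp
    refine ⟨Set.univ, ⟨⟨hB.ge, isClosed_univ, ?_, ?_⟩, fun x hx => ?_⟩⟩
    · refine Set.eq_empty_of_forall_notMem fun f hf => ?_
      have : ‖WeakDual.toStrongDual f‖ = 1 := hf.2
      rw [Subsingleton.elim f 0] at this
      simp at this
    · rw [hneg, hB, Set.extremePoints_eq_self, closure_univ, Set.union_self]
    · rw [Subsingleton.elim x 0, norm_zero] at hx
      exact absurd hx zero_ne_one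
  set E := Set.range (adjointEval T) ∩ dualSphere X with hE
  have hsub : E ⊆ (dualBall X).extremePoints ℝ := by
    rintro _ ⟨⟨k, rfl⟩, hk⟩
    exact adjointEval_mem_extremePoints hT hk
  have hext : E ∪ -E = (dualBall X).extremePoints ℝ := by
    apply Set.Subset.antisymm
    · rintro f (hf | hf)
      · exact hsub hf
      · simpa using neg_mem_extremePoints_dualBall (hsub hf)
    · intro f hf
      rcases extremePoints_dualBall_subset T hf with h | h
      · exact Or.inl ⟨h, extremePoints_dualBall_subset_dualSphere hf⟩
      · exact Or.inr ⟨h, extremePoints_dualBall_subset_dualSphere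
          (neg_mem_extremePoints_dualBall hf)⟩
  have hEc : IsClosed E := by
    have : E = Set.range (adjointEval T) ∩
        StrongDual.toWeakDual '' Metric.sphere (0 : StrongDual ℝ X) 1 := by
      rw [hE]
      congr 1
      ext f
      constructor
      · intro hf
        exact ⟨WeakDual.toStrongDual f, mem_sphere_zero_iff_norm.2 hf, rfl⟩
      · rintro ⟨g, hg, rfl⟩
        exact mem_sphere_zero_iff_norm.1 hg
    rw [this]
    have := FiniteDimensional.proper ℝ (StrongDual ℝ X)
    exact (isCompact_range (continuous_adjointEval T)).isClosed.inter
      ((isCompact_sphere _ _).image NormedSpace.Dual.toWeakDual_continuous).isClosed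
  refine ⟨E, ⟨⟨fun f hf => (hsub hf).1, hEc, ?_, ?_⟩, fun x hx => ?_⟩⟩
  · refine Set.eq_empty_of_forall_notMem ?_
    rintro f ⟨⟨⟨⟨k, rfl⟩, hk⟩, ⟨⟨l, hl⟩, -⟩⟩, -⟩
    exact neg_adjointEval_ne hT hk (l := l) (by rw [hl, neg_neg])
  · rw [← hext, (hEc.union hEc.neg).closure_eq]
  · apply Set.Subset.antisymm
    · exact fun f hf => ⟨hf.1, subset_closure <|
        inter_extremePoints_subset_extremePoints_of_subset (isExtreme_dualFace hx).1
          ⟨hf.2, hsub hf.1⟩⟩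
    · exact Set.inter_subset_inter_right _
        (closure_minimal extremePoints_subset (isClosed_dualFace hx))

/-- Functionals in a convex subset of the dual sphere are affinely independent if they have linearly
independent Hahn--Banach extensions through a U-embedding. -/
theorem IsUEmbedding.linearIndependent_prod_one {Y : Type v} [NormedAddCommGroup Y]
    [NormedSpace ℝ Y] {T : X →ₗᵢ[ℝ] Y} (hT : IsUEmbedding T) {F : Set (WeakDual ℝ X)}
    (hconv : Convex ℝ F) (hsph : F ⊆ dualSphere X) {ι : Type*} {z : ι → WeakDual ℝ X}
    (hz : ∀ i, z i ∈ F) {μ : ι → StrongDual ℝ Y} (hμ : LinearIndependent ℝ μ)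
    (hμ1 : ∀ i, ‖μ i‖ ≤ 1) (hμT : ∀ i x, μ i (T x) = z i x) :
    LinearIndependent ℝ fun i => (z i, (1 : ℝ)) := by
  rw [linearIndependent_iff'] at hμ ⊢
  intro s g hg
  have hfst : ∑ e ∈ s, g e • z e = 0 := by
    simpa [Prod.fst_sum] using congrArg Prod.fst hg
  have hsnd : ∑ e ∈ s, g e = 0 := by
    simpa [Prod.snd_sum] using congrArg Prod.snd hg
  set A := ∑ e ∈ s, (g e)⁺ with hA
  have hAneg : A = ∑ e ∈ s, (g e)⁻ := by
    rw [hA, ← sub_eq_zero, ← Finset.sum_sub_distrib]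
    simpa using hsnd
  have hA0 : 0 ≤ A := Finset.sum_nonneg fun e _ => posPart_nonneg _
  -- If `A = 0`, all coefficients vanish; otherwise dividing by `A` gives two convex combinations of
  -- the same functional in `F`, whose extensions must coincide.
  rcases hA0.eq_or_lt with h | hApos
  · intro e he
    have h1 := (Finset.sum_eq_zero_iff_of_nonneg fun e _ => posPart_nonneg (g e)).1
      (hA.symm.trans h.symm) e he
    have h2 := (Finset.sum_eq_zero_iff_of_nonneg fun e _ => negPart_nonneg (g e)).1
      (hAneg.symm.trans h.symm) e he
    rw [← posPart_sub_negPart (g e), h1, h2, sub_zero]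
  have hfsum : ∑ e ∈ s, ((g e)⁺ / A) • z e = ∑ e ∈ s, ((g e)⁻ / A) • z e :=
    (sum_posPart_div_smul_eq_iff hApos.ne').2 hfst
  have hmem : ∑ e ∈ s, ((g e)⁺ / A) • z e ∈ F :=
    hconv.sum_mem (fun e _ => div_nonneg (posPart_nonneg _) hA0)
      (by rw [← Finset.sum_div, ← hA, div_self hApos.ne']) fun e _ => hz e
  have hball : ∀ w : ι → ℝ, (∀ e, 0 ≤ w e) → ∑ e ∈ s, w e = 1 →
      ‖∑ e ∈ s, w e • μ e‖ ≤ 1 := fun w hw hw1 =>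
    norm_sum_smul_le_one (fun e _ => hw e) hw1 fun e _ => hμ1 e
  have hcomp : ∀ w : ι → ℝ,
      (∑ e ∈ s, w e • μ e).comp T.toContinuousLinearMap =
        WeakDual.toStrongDual (∑ e ∈ s, w e • z e) := fun w => by
    ext x
    rw [map_sum]
    simp [hμT]
  have heq := hT.eq_of_comp_eq (hsph hmem)
    (hball _ (fun e => div_nonneg (posPart_nonneg (g e)) hA0)
      (by rw [← Finset.sum_div, ← hA, div_self hApos.ne']))
    (hball _ (fun e => div_nonneg (negPart_nonneg (g e)) hA0)
      (by rw [← Finset.sum_div, ← hAneg, div_self hApos.ne']))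
    (hcomp _) ((hcomp _).trans (by rw [hfsum]))
  exact hμ s g ((sum_posPart_div_smul_eq_iff hApos.ne').1 heq)

/-- If `X` has a U-embedding into a `C(K)` space, the extreme points of each convex extreme subset
of the dual sphere are affinely independent. -/
theorem IsUEmbedding.linearIndependent_extremePoints [T2Space K] [FiniteDimensional ℝ X]
    [Nontrivial X] {T : X →ₗᵢ[ℝ] C(K, ℝ)} (hT : IsUEmbedding T) {F : Set (WeakDual ℝ X)}
    (hF : IsExtreme ℝ (dualBall X) F) (hconv : Convex ℝ F) (hsph : F ⊆ dualSphere X) :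
    LinearIndependent ℝ fun e : F.extremePoints ℝ => ((e : WeakDual ℝ X), (1 : ℝ)) := by
  have hsign : ∀ e : F.extremePoints ℝ, ∃ (k : K) (ε : ℝ), |ε| = 1 ∧
      (e : WeakDual ℝ X) = ε • adjointEval T k := fun e => by
    rcases extremePoints_dualBall_subset T (hF.extremePoints_subset_extremePoints e.2) with
      ⟨k, hk⟩ | ⟨k, hk⟩
    · exact ⟨k, 1, by simp, by rw [hk, one_smul]⟩
    · exact ⟨k, -1, by simp, by rw [hk, neg_one_smul, neg_neg]⟩
  choose k ε hε hk using hsign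
  have hε0 : ∀ e, ε e ≠ 0 := fun e he => by simpa [he] using hε e
  -- The same `k` with opposite signs would put the midpoint `0` of `e` and `-e` in `F`, inside the
  -- sphere.
  have hkinj : Function.Injective k := fun e e' h => by
    have hcases : ε e = ε e' ∨ ε e = -ε e' := abs_eq_abs.1 ((hε e).trans (hε e').symm)
    rcases hcases with h' | h'
    · exact Subtype.ext (by rw [hk, hk, h, h'])
    · exfalso
      have hneg : (e : WeakDual ℝ X) = -e' := by rw [hk e, hk e', h, h', neg_smul]
      have h0 : (0 : WeakDual ℝ X) ∈ F := by
        have := hconv e.2.1 e'.2.1 (by norm_num : (0 : ℝ) ≤ 1 / 2) (by norm_num : (0 : ℝ) ≤ 1 / 2)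
          (by norm_num)
        rwa [hneg, smul_neg, neg_add_cancel] at this
      have : ‖WeakDual.toStrongDual (0 : WeakDual ℝ X)‖ = 1 := hsph h0
      simp at this
  let μ : F.extremePoints ℝ → StrongDual ℝ C(K, ℝ) := fun e => ε e • ContinuousMap.evalCLM ℝ (k e)
  have hμ : LinearIndependent ℝ μ := linearIndependent_smul_evalCLM hkinj hε0
  have hμ1 : ∀ e, ‖μ e‖ ≤ 1 := fun e => by
    refine ContinuousLinearMap.opNorm_le_bound _ zero_le_one fun f => ?_
    change |ε e * f (k e)| ≤ 1 * ‖f‖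
    rw [abs_mul, hε]
    simpa using f.norm_coe_le_norm (k e)
  have hμT : ∀ e x, μ e (T x) = (e : WeakDual ℝ X) x := fun e x => by
    rw [hk e]
    rfl
  exact hT.linearIndependent_prod_one hconv hsph (fun e => e.2.1) hμ hμ1 hμT

theorem IsUEmbedding.isSimplexoid_dualBall [T2Space K] [FiniteDimensional ℝ X]
    {T : X →ₗᵢ[ℝ] C(K, ℝ)} (hT : IsUEmbedding T) : IsSimplexoid (dualBall X) := by
  refine ⟨isCompact_dualBall, convex_dualBall, ?_⟩
  rintro F ⟨hF, hconv, hclosed, hne, hproper⟩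
  have hsph := hF.subset_dualSphere hproper
  have : Nontrivial X := by
    obtain ⟨x, hx, -⟩ := exists_mem_dualFace (hsph hne.some_mem)
    exact nontrivial_of_ne x 0 fun h => by simp [h] at hx
  exact isChoquetSimplex_of_linearIndependent (isCompact_dualBall.of_isClosed_subset hclosed hF.1)
    hconv hne (hT.linearIndependent_extremePoints hF hconv hsph)

end Necessity

/-! ### Sufficiency: evaluation on a proper U-suitable set. -/

section Sufficiency

theorem exists_isHahnBanachExtension {X : Type u} [NormedAddCommGroup X] [NormedSpace ℝ X]
    {Y : Type v} [NormedAddCommGroup Y] [NormedSpace ℝ Y] (T : X →ₗᵢ[ℝ] Y)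
    (f : StrongDual ℝ X) : ∃ g : StrongDual ℝ Y, IsHahnBanachExtension T f g := by
  let e : X ≃ₗᵢ[ℝ] LinearMap.range T.toLinearMap := T.equivRange
  let f' : StrongDual ℝ (LinearMap.range T.toLinearMap) :=
    f.comp (e.symm.toLinearIsometry.toContinuousLinearMap)
  obtain ⟨g, hg, hgn⟩ := exists_extension_norm_eq _ f'
  have hgT : g.comp T.toContinuousLinearMap = f := by
    ext x
    have h1 : g (T x) = f (e.symm (e x)) := hg (e x)
    rw [e.symm_apply_apply] at h1
    exact h1
  refine ⟨g, hgT, le_antisymm ?_ ?_⟩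
  · rw [hgn]
    refine ContinuousLinearMap.opNorm_le_bound _ (norm_nonneg f) fun y => ?_
    rw [← e.symm.norm_map y]
    exact f.le_opNorm (e.symm y)
  · rw [← hgT]
    refine ContinuousLinearMap.opNorm_le_bound _ (norm_nonneg g) fun x => ?_
    simpa using g.le_opNorm (T x)

variable {K : Type v} [TopologicalSpace K] [CompactSpace K]

/-- A norm-one functional on `C(K)` that attains its norm at `h` is concentrated on the set where
`|h| = 1`. -/
theorem apply_eq_zero_of_eqOn_abs_eq_one {μ : StrongDual ℝ C(K, ℝ)} (hμ : ‖μ‖ ≤ 1) {h : C(K, ℝ)}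
    (hh : ‖h‖ ≤ 1) (hμh : μ h = 1) {g : C(K, ℝ)} (hg : ∀ k, |h k| = 1 → g k = 0) : μ g = 0 := by
  have hle : ∀ f : C(K, ℝ), μ f ≤ ‖f‖ := fun f =>
    (le_abs_self _).trans <| (μ.le_of_opNorm_le hμ f).trans_eq (one_mul _)
  have key : ∀ g : C(K, ℝ), (∀ k, |h k| = 1 → g k = 0) → ∀ ε > 0, μ g ≤ ε := by
    intro g hg ε hε
    have hh1 : ∀ k, |h k| ≤ 1 := fun k => (h.norm_coe_le_norm k).trans hh
    have hC : IsCompact {k | ε ≤ |g k|} :=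
      (isClosed_le continuous_const g.continuous.abs).isCompact
    -- Compactness keeps `|h|` away from `1` where `|g| ≥ ε`.
    obtain ⟨η, hη, hηC⟩ : ∃ η > 0, ∀ k, ε ≤ |g k| → |h k| ≤ 1 - η := by
      rcases {k | ε ≤ |g k|}.eq_empty_or_nonempty with hemp | hne
      · exact ⟨1, one_pos, fun k hk => absurd (show k ∈ {k | ε ≤ |g k|} from hk) (by simp [hemp])⟩
      · obtain ⟨k₀, hk₀, hmax⟩ := hC.exists_isMaxOn hne h.continuous.abs.continuousOn
        refine ⟨1 - |h k₀|, sub_pos.2 (lt_of_le_of_ne (hh1 k₀) fun he => ?_), fun k hk => ?_⟩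
        · have : ε ≤ |g k₀| := hk₀
          rw [hg k₀ he, abs_zero] at this
          linarith
        · have : |h k| ≤ |h k₀| := hmax hk
          linarith
    -- Chosen so that `t * ‖g‖ ≤ η`: adding `t • g` to `h` then raises the norm above `1` by at most
    -- `t * ε`. Evaluating `μ` gives `1 + t * μ g ≤ 1 + t * ε`.
    set t := η / (‖g‖ + 1) with ht
    have hg0 := norm_nonneg g
    have ht0 : 0 < t := by positivity
    have htg : t * ‖g‖ ≤ η := by
      rw [ht, div_mul_eq_mul_div, div_le_iff₀ (by positivity)]
      nlinarith
    have hnorm : ‖h + t • g‖ ≤ 1 + t * ε := by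
      refine (ContinuousMap.norm_le _ (by positivity)).2 fun k => ?_
      have h1 : ‖(h + t • g) k‖ ≤ |h k| + t * |g k| := by
        refine (abs_add_le _ _).trans_eq ?_
        simp [abs_mul, abs_of_pos ht0]
      refine h1.trans ?_
      rcases le_or_gt ε |g k| with hk | hk
      · have h2 := hηC k hk
        have h3 : t * |g k| ≤ t * ‖g‖ := mul_le_mul_of_nonneg_left (g.norm_coe_le_norm k) ht0.le
        have h4 : 0 < t * ε := by positivity
        linarith
      · have h3 : t * |g k| ≤ t * ε := mul_le_mul_of_nonneg_left hk.le ht0.le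
        linarith [hh1 k]
    have h5 := (hle _).trans hnorm
    rw [map_add, map_smul, hμh, smul_eq_mul] at h5
    exact le_of_mul_le_mul_left (by linarith) ht0
  refine le_antisymm (le_of_forall_pos_le_add fun ε hε => by simpa using key g hg ε hε) ?_
  have : -μ g ≤ 0 := le_of_forall_pos_le_add fun ε hε => by
    simpa using key (-g) (fun k hk => by simp [hg k hk]) ε hε
  linarith

/-- Row rank equals column rank for the joint evaluation map `R`. -/
theorem exists_apply_eq_of_linearIndependent {X : Type u} [NormedAddCommGroup X] [NormedSpace ℝ X]
    {ι : Type*} [Finite ι] {z : ι → WeakDual ℝ X} (hz : LinearIndependent ℝ z) (c : ι → ℝ) :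
    ∃ x : X, ∀ i, z i x = c i := by
  have hz' : LinearIndependent ℝ fun i (x : X) => z i x := by
    let L : WeakDual ℝ X →ₗ[ℝ] X → ℝ :=
      { toFun := fun f x => f x
        map_add' := fun _ _ => rfl
        map_smul' := fun _ _ => rfl }
    exact hz.map' L (LinearMap.ker_eq_bot.2 DFunLike.coe_injective)
  let R : X →ₗ[ℝ] ι → ℝ :=
    { toFun := fun x i => z i x
      map_add' := fun x y => funext fun i => map_add _ _ _
      map_smul' := fun a x => funext fun i => map_smul _ _ _ }
  have hR : LinearMap.range R = ⊤ := by
    rw [← span_flip_eq_top_iff_linearIndependent.2 hz']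
    exact (Submodule.span_eq (LinearMap.range R)).symm
  obtain ⟨x, hx⟩ := LinearMap.range_eq_top.1 hR c
  exact ⟨x, fun i => congrFun hx i⟩

variable {X : Type u} [NormedAddCommGroup X] [NormedSpace ℝ X]

/-- The restriction of the canonical evaluation of `X` along a parametrized norming subset of the
dual ball. -/
noncomputable def evalEmbedding (φ : C(K, WeakDual ℝ X)) (hφ : ∀ k, φ k ∈ dualBall X)
    (hext : (dualBall X).extremePoints ℝ ⊆ Set.range φ ∪ -Set.range φ) : X →ₗᵢ[ℝ] C(K, ℝ) where
  toFun x := ⟨fun k => φ k x, (WeakDual.eval_continuous x).comp φ.continuous⟩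
  map_add' x y := ContinuousMap.ext fun k => map_add (WeakDual.toStrongDual (φ k)) x y
  map_smul' a x := ContinuousMap.ext fun k => map_smul (WeakDual.toStrongDual (φ k)) a x
  norm_map' x := by
    set g : C(K, ℝ) := ⟨fun k => φ k x, (WeakDual.eval_continuous x).comp φ.continuous⟩
    change ‖g‖ = ‖x‖
    refine le_antisymm ((ContinuousMap.norm_le _ (norm_nonneg x)).2 fun k =>
      abs_apply_le_of_mem_dualBall (hφ k) x) ?_
    have hC : IsClosed {f : WeakDual ℝ X | |f x| ≤ ‖g‖} :=
      isClosed_le (WeakDual.eval_continuous x).abs continuous_const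
    have hconv : Convex ℝ {f : WeakDual ℝ X | |f x| ≤ ‖g‖} := by
      intro f hf f' hf' a b ha hb hab
      exact mem_closedBall_zero_iff.1 <| convex_closedBall (0 : ℝ) ‖g‖
        (mem_closedBall_zero_iff.2 hf) (mem_closedBall_zero_iff.2 hf') ha hb hab
    -- By Krein–Milman a bound at `x` on the extreme points holds on the whole ball, including at a
    -- functional norming `x`.
    have hB : dualBall X ⊆ {f : WeakDual ℝ X | |f x| ≤ ‖g‖} := by
      rw [← closure_convexHull_extremePoints isCompact_dualBall convex_dualBall]
      refine closure_minimal (convexHull_min (hext.trans ?_) hconv) hC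
      rintro f (⟨k, rfl⟩ | ⟨k, hk⟩)
      · exact g.norm_coe_le_norm k
      · have h1 : g k = -f x := congrArg (fun τ : WeakDual ℝ X => τ x) hk
        have h2 := g.norm_coe_le_norm k
        rw [h1, norm_neg] at h2
        exact h2
    obtain ⟨f, hf, hfx⟩ := exists_dual_vector'' ℝ x
    have h3 : |f x| ≤ ‖g‖ := hB (show StrongDual.toWeakDual f ∈ dualBall X from hf)
    rw [hfx] at h3
    simpa using h3

theorem IsSimplexoid.linearIndependent_extremePoints_dualFace
    (hS : IsSimplexoid (dualBall X)) {x : X} (hx : ‖x‖ = 1) :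
    LinearIndependent ℝ fun e : (dualFace x).extremePoints ℝ =>
      ((e : WeakDual ℝ X), (1 : ℝ)) := by
  rcases (dualFace x).eq_empty_or_nonempty with hemp | hne
  · have : IsEmpty ((dualFace x).extremePoints ℝ) := by
      rw [hemp, extremePoints_empty]
      infer_instance
    exact linearIndependent_empty_type
  refine (hS.2.2 (dualFace x) ⟨isExtreme_dualFace hx, convex_dualFace hx, isClosed_dualFace hx,
    hne, fun h => ?_⟩).2.2.linearIndependent_extremePoints (convex_dualFace hx)
  have h0 : (0 : WeakDual ℝ X) ∈ dualFace x := by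
    rw [h]
    simp [dualBall]
  exact zero_ne_one h0.2

theorem isUEmbedding_evalEmbedding [FiniteDimensional ℝ X] {E : Set (WeakDual ℝ X)}
    (hE : IsProperUSuitable E) (hS : IsSimplexoid (dualBall X)) (φ : C(K, WeakDual ℝ X))
    (hinj : Function.Injective φ) (hφE : Set.range φ = E) (hφ : ∀ k, φ k ∈ dualBall X)
    (hext : (dualBall X).extremePoints ℝ ⊆ Set.range φ ∪ -Set.range φ) :
    IsUEmbedding (evalEmbedding φ hφ hext) := by
  set T := evalEmbedding φ hφ hext with hT
  have hTapp : ∀ x k, T x k = φ k x := fun x k => rfl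
  intro f hf
  obtain ⟨x, hx, hfx⟩ := exists_mem_dualFace (f := StrongDual.toWeakDual f) hf
  have hfx1 : f x = 1 := hfx.2
  have hfin := fun y (hy : ‖y‖ = 1) =>
    finite_of_linearIndependent_prod_one (hS.linearIndependent_extremePoints_dualFace (x := y) hy)
  -- Properness is used here; the face has finitely many extreme points, so the closure adds
  -- nothing.
  have hface : ∀ y, ‖y‖ = 1 → ∀ k, φ k y = 1 → φ k ∈ (dualFace y).extremePoints ℝ := by
    intro y hy k hk
    have h1 : φ k ∈ E ∩ dualFace y := ⟨hφE ▸ ⟨k, rfl⟩, by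
      rw [dualFace_eq hy]
      exact ⟨hφ k, hk⟩⟩
    rw [hE.inter_face y hy, (hfin y hy).isClosed.closure_eq] at h1
    exact h1.2
  have hnegface : ∀ g ∈ (dualFace (-x)).extremePoints ℝ, -g ∈ (dualFace x).extremePoints ℝ := by
    intro g hg
    have hg' := (isExtreme_dualFace (x := -x) (by simpa using hx)).extremePoints_subset_extremePoints
      hg
    refine inter_extremePoints_subset_extremePoints_of_subset (isExtreme_dualFace hx).1
      ⟨?_, neg_mem_extremePoints_dualBall hg'⟩
    rw [dualFace_eq hx]
    refine ⟨(neg_mem_extremePoints_dualBall hg').1, ?_⟩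
    have : g (-x) = 1 := hg.1.2
    rwa [map_neg] at this
  let Z := {k : K // |φ k x| = 1}
  have hZ : ∀ k : Z, φ k x • φ k ∈ (dualFace x).extremePoints ℝ := by
    rintro ⟨k, hk⟩
    rcases (abs_eq zero_le_one).1 hk with h | h
    · simpa [h] using hface x hx k h
    · have := hnegface _ (hface (-x) (by simpa using hx) k (by rw [map_neg, h, neg_neg]))
      simpa [h] using this
  let σ : Z → (dualFace x).extremePoints ℝ := fun k => ⟨φ k x • φ k, hZ k⟩
  -- Coincidence up to sign is excluded by `E ∩ (-E) ∩ dualSphere X = ∅`.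
  have hσ : Function.Injective σ := by
    rintro ⟨k, hk⟩ ⟨l, hl⟩ hkl
    have hkl' : φ k x • φ k = φ l x • φ l := congrArg Subtype.val hkl
    have hkE : φ k ∈ E := hφE ▸ ⟨k, rfl⟩
    have hlE : φ l ∈ E := hφE ▸ ⟨l, rfl⟩
    have hksph : φ k ∈ dualSphere X := by
      refine le_antisymm (hφ k) ?_
      have := (WeakDual.toStrongDual (φ k)).le_opNorm x
      rw [hx, mul_one] at this
      exact hk.symm.le.trans this
    have hno : φ l ≠ -φ k := fun h => by
      have : φ k ∈ E ∩ (-E) ∩ dualSphere X := ⟨⟨hkE, by rw [Set.mem_neg, ← h]; exact hlE⟩, hksph⟩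
      rw [hE.inter_neg] at this
      exact this
    have hno' : φ k ≠ -φ l := fun h => hno (by rw [h, neg_neg])
    refine Subtype.ext (hinj ?_)
    rcases (abs_eq zero_le_one).1 hk with h | h <;> rcases (abs_eq zero_le_one).1 hl with h' | h' <;>
      rw [h, h'] at hkl' <;> simp only [one_smul, neg_smul, neg_inj] at hkl'
    · exact hkl'
    · exact absurd hkl' hno'
    · exact absurd hkl'.symm hno
    · exact hkl'
  have : Finite ((dualFace x).extremePoints ℝ) := (hfin x hx).to_subtype
  have hZfin : Finite Z := Finite.of_injective σ hσ
  -- All these points take the value `1` at `x`, so every linear relation among them is affine.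
  have hli : LinearIndependent ℝ fun e : (dualFace x).extremePoints ℝ => (e : WeakDual ℝ X) := by
    have h1 := hS.linearIndependent_extremePoints_dualFace hx
    rw [linearIndependent_iff'] at h1 ⊢
    intro s g hg
    refine h1 s g ?_
    have hsum : ∑ e ∈ s, g e = 0 := by
      have h2 := congrArg (fun τ : WeakDual ℝ X => τ x) hg
      have h3 : ∀ τ : WeakDual ℝ X, τ x = WeakDual.toStrongDual τ x := fun _ => rfl
      simp only [h3, map_sum, map_smul, map_zero, _root_.sum_apply, _root_.smul_apply,
        _root_.zero_apply] at h2
      rw [← h2]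
      refine Finset.sum_congr rfl fun e _ => ?_
      rw [← h3, e.2.1.2, smul_eq_mul, mul_one]
    ext1
    · simpa [Prod.fst_sum] using hg
    · simpa [Prod.snd_sum] using hsum
  have hZli := hli.comp σ hσ
  have hnorm : ∀ μ : StrongDual ℝ C(K, ℝ), IsHahnBanachExtension T f μ →
      ∀ y, μ (T y) = f y := fun μ hμ y => by rw [← hμ.1]; rfl
  obtain ⟨μ₀, hμ₀⟩ := exists_isHahnBanachExtension T f
  refine ⟨μ₀, hμ₀, fun μ hμ => ?_⟩
  ext g
  -- The target carries the sign `φ k x` because `σ k = φ k x • φ k`; thus `T y = g` on `Z`.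
  obtain ⟨y, hy⟩ := exists_apply_eq_of_linearIndependent hZli fun k => φ k x * g k
  have hvan : ∀ k, |T x k| = 1 → (g - T y) k = 0 := by
    intro k hk
    have h1 : φ k x * φ k y = φ k x * g k := hy ⟨k, hk⟩
    have h2 : φ k x ≠ 0 := fun h => by rw [hTapp, h] at hk; simp at hk
    rw [ContinuousMap.sub_apply, hTapp, mul_left_cancel₀ h2 h1, sub_self]
  have hval : ∀ ν, IsHahnBanachExtension T f ν → ν g = f y := fun ν hν => by
    have := apply_eq_zero_of_eqOn_abs_eq_one (hν.2.trans hf).le (by rw [T.norm_map, hx])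
      ((hnorm ν hν x).trans hfx1) hvan
    rw [map_sub, sub_eq_zero, hnorm ν hν] at this
    exact this
  rw [hval μ hμ, hval μ₀ hμ₀]

end Sufficiency

theorem mainTheorem4 (X : Type u) [NormedAddCommGroup X] [NormedSpace ℝ X]
    [FiniteDimensional ℝ X] :
    UEmbedsInSomeCK.{u, v} X ↔
      (∃ E : Set (WeakDual ℝ X), IsProperUSuitable E) ∧ IsSimplexoid (dualBall X) := by
  constructor
  · rintro ⟨K, _, _, _, T, hT⟩
    exact ⟨exists_isProperUSuitable hT, hT.isSimplexoid_dualBall⟩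
  · rintro ⟨⟨E, hE⟩, hS⟩
    -- Coordinates embed `E` in a power of `ℝ`, so a copy of it lives in the universe required of
    -- `K`.
    have hsmall : Small.{v} E := by
      let b := Module.finBasis ℝ X
      refine small_of_injective (β := Fin (Module.finrank ℝ X) → ℝ)
        (f := fun e i => (e : WeakDual ℝ X) (b i)) fun e e' h => Subtype.ext ?_
      apply (WeakDual.toStrongDual (𝕜 := ℝ) (E := X)).injective
      exact ContinuousLinearMap.coe_injective (b.ext fun i => congrFun h i)
    have hEc : CompactSpace E := isCompact_iff_compactSpace.1
      (isCompact_dualBall.of_isClosed_subset hE.isClosed hE.subset_ball)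
    let ψ : Shrink.{v} E ≃ₜ E := (Shrink.homeomorph E).symm
    have : CompactSpace (Shrink.{v} E) := ψ.symm.compactSpace
    have : T2Space (Shrink.{v} E) := ψ.symm.t2Space
    let φ : C(Shrink.{v} E, WeakDual ℝ X) := ⟨fun k => ψ k, by fun_prop⟩
    have hrange : Set.range φ = E := by
      rw [show (φ : Shrink.{v} E → WeakDual ℝ X) = Subtype.val ∘ ψ from rfl,
        ψ.surjective.range_comp, Subtype.range_coe]
    exact ⟨Shrink.{v} E, inferInstance, inferInstance, inferInstance,
      evalEmbedding φ (fun k => hE.subset_ball (ψ k).2)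
        (by rw [hrange, hE.union_neg]; exact subset_closure),
      isUEmbedding_evalEmbedding hE hS φ (Subtype.val_injective.comp ψ.injective) hrange _ _⟩
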